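/- **Theorem (Frobenius pull-back formula).** Let $p$ be a prime, let $V$ be a complete discrete valuation ring whose maximal ideal is $pV$ and whose residue field is perfect, and let $d\ge 1$. Put $R=V[[x_2,\dots,x_d]]$ with maximal ideal $\mathfrak m$, let $$R_e=V[p^{1/p^e}][[x_2^{1/p^e},\dots,x_d^{1/p^e}]]\quad(e\ge 0),\qquad R_\infty=\bigcup_{e\ge 0}R_e ,$$ the union being taken along the inclusions $R_e\hookrightarrow R_{e+1}$ for which $p^{1/p^e}=(p^{1/p^{e+1}})^p$ and $x_i^{1/p^e}=(x_i^{1/p^{e+1}})^p$. An $R_\infty$-module is called $\mathfrak m$-torsion if each of its elements is annihilated by some power of $\mathfrak m$. For an $\mathfrak m$-torsion $R_\infty$-module $M$ the normalized length $\lambda_\infty(M)\in[0,\infty]$ is defined as follows. 1. If $M$ is finitely presented, write $M\cong\operatorname{coker}(\varphi:R_\infty^{b}\to R_\infty^{a})$ with a matrix $\varphi$ whose entries lie in some $R_n$, put $M_n=\operatorname{coker}(\varphi:R_n^{b}\to R_n^{a})$, and set $\lambda_\infty(M)=p^{-dn}\,\ell_{R_n}(M_n)$, where $\ell_{R_n}$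 is the length over $R_n$ (this does not depend on the choices). 2. If $M$ is finitely generated, $\lambda_\infty(M)=\inf_N\lambda_\infty(N)$ over all finitely presented $\mathfrak m$-torsion $R_\infty$-modules $N$ that admit a surjection $N\twoheadrightarrow M$. 3. In general, $\lambda_\infty(M)=\sup_N\lambda_\infty(N)$ over all finitely generated submodules $N\subseteq M$. For an $R_\infty$-module $M$ with $pM=0$, let $M^{[F]}$ be the $R_\infty$-module with the same underlying abelian group as $M$, on which $a\in R_\infty$ acts as $a^p$ does on $M$. Let $M$ be an $\mathfrak m$-torsion $R_\infty/pR_\infty$-module, that is, an $\mathfrak m$-torsion $R_\infty$-module with $pM=0$. Then $$\lambda_\infty(M^{[F]})=\frac{1}{p^{d}}\,\lambda_\infty(M),$$ where both sides may be $\infty$. -/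

import Mathlib

open scoped ENNReal

universe u w

noncomputable section

namespace NormalizedLength

/-! ### The tower of regular local rings -/

section Tower

variable (V : Type u) [CommRing V] (p d : ℕ)

/-- The ring `V_e = V[p^{1/p^e}]`, presented as `V[T] / (T^{p^e} - p)`. -/
abbrev RootRing (e : ℕ) : Type u :=
  AdjoinRoot (Polynomial.X ^ (p ^ e) - Polynomial.C (p : V) : Polynomial V)

/-- The element `p^{1/p^e}` of `V_e`. -/
def pRoot (e : ℕ) : RootRing V p e :=
  AdjoinRoot.root (Polynomial.X ^ (p ^ e) - Polynomial.C (p : V) : Polynomial V)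

theorem pRoot_pow (e : ℕ) : pRoot V p e ^ (p ^ e) = (p : RootRing V p e) := by
  have h := AdjoinRoot.eval₂_root
    (Polynomial.X ^ (p ^ e) - Polynomial.C (p : V) : Polynomial V)
  rw [Polynomial.eval₂_sub, Polynomial.eval₂_pow, Polynomial.eval₂_X, Polynomial.eval₂_C,
    map_natCast, sub_eq_zero] at h
  exact h

/-- The transition map `V_i → V_j` for `i ≤ j`: the map of `V`-algebras that sends `p^{1/p^i}` to
`(p^{1/p^j})^{p^{j-i}}`. -/
def rootTransition (i j : ℕ) (h : i ≤ j) : RootRing V p i →+* RootRing V p j :=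
  AdjoinRoot.lift (AdjoinRoot.of _) (pRoot V p j ^ (p ^ (j - i))) (by
    simp only [Polynomial.eval₂_sub, Polynomial.eval₂_pow, Polynomial.eval₂_X,
      Polynomial.eval₂_natCast, map_natCast]
    rw [← pow_mul, ← pow_add, Nat.sub_add_cancel h, pRoot_pow, sub_self])

theorem rootTransition_pRoot (i j : ℕ) (h : i ≤ j) :
    rootTransition V p i j h (pRoot V p i) = pRoot V p j ^ (p ^ (j - i)) :=
  AdjoinRoot.lift_root _

theorem rootTransition_of (i j : ℕ) (h : i ≤ j) (v : V) :
    rootTransition V p i j h (AdjoinRoot.of _ v) = AdjoinRoot.of _ v :=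
  AdjoinRoot.lift_of _

theorem rootTransition_self (i : ℕ) (x : RootRing V p i) :
    rootTransition V p i i le_rfl x = x := by
  have : rootTransition V p i i le_rfl = RingHom.id _ := by
    refine AdjoinRoot.ringHom_ext ?_ ?_
    · ext v
      exact rootTransition_of V p i i le_rfl v
    · have h := rootTransition_pRoot V p i i le_rfl
      rw [Nat.sub_self, pow_zero, pow_one] at h
      exact h
  rw [this, RingHom.id_apply]

theorem rootTransition_comp (i j k : ℕ) (hij : i ≤ j) (hjk : j ≤ k) :
    (rootTransition V p j k hjk).comp (rootTransition V p i j hij) =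
      rootTransition V p i k (hij.trans hjk) := by
  refine AdjoinRoot.ringHom_ext ?_ ?_
  · ext v
    simp only [RingHom.comp_apply, rootTransition_of]
  · change rootTransition V p j k hjk (rootTransition V p i j hij (pRoot V p i)) =
      rootTransition V p i k _ (pRoot V p i)
    rw [rootTransition_pRoot, map_pow, rootTransition_pRoot, rootTransition_pRoot, ← pow_mul,
      ← pow_add]
    congr 2
    omega

/-- The ring `R_e = V[p^{1/p^e}][[x_2^{1/p^e}, …, x_d^{1/p^e}]]`: formal power series over `V_e` in
`d - 1` variables, the variables of `R_e` being the `x_i^{1/p^e}`. -/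
abbrev Level (e : ℕ) : Type u :=
  MvPowerSeries (Fin (d - 1)) (RootRing V p e)

variable [Fact p.Prime]

/-- The transition map `R_i → R_j` for `i ≤ j`: it is `V_i → V_j` on coefficients and sends the
variable `x^{1/p^i}` to `(x^{1/p^j})^{p^{j-i}}`. -/
def levelTransition (i j : ℕ) (h : i ≤ j) : Level V p d i →+* Level V p d j :=
  (MvPowerSeries.expand (p ^ (j - i))
      (pow_ne_zero _ (Fact.out : p.Prime).ne_zero)).toRingHom.comp
    (MvPowerSeries.map (rootTransition V p i j h))

instance : DirectedSystem (Level V p d) (levelTransition V p d · · ·) where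
  map_self i x := by
    have h1 : MvPowerSeries.map (rootTransition V p i i le_rfl) x = x := by
      ext n
      rw [MvPowerSeries.coeff_map, rootTransition_self]
    have h2 : ∀ (m : ℕ) (hm : m ≠ 0), m = 1 → ∀ y : Level V p d i,
        MvPowerSeries.expand m hm y = y := by
      rintro m hm rfl y
      exact MvPowerSeries.expand_one_apply y
    change MvPowerSeries.expand (p ^ (i - i)) (pow_ne_zero _ (Fact.out : p.Prime).ne_zero)
      (MvPowerSeries.map (rootTransition V p i i le_rfl) x) = x
    rw [h1]
    exact h2 _ _ (by simp) x
  map_map k j i hij hjk x := by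
    have hp0 : ∀ m : ℕ, p ^ m ≠ 0 := fun m => pow_ne_zero _ (Fact.out : p.Prime).ne_zero
    change MvPowerSeries.expand (p ^ (k - j)) (hp0 _) (MvPowerSeries.map (rootTransition V p j k hjk)
      (MvPowerSeries.expand (p ^ (j - i)) (hp0 _)
        (MvPowerSeries.map (rootTransition V p i j hij) x))) =
      MvPowerSeries.expand (p ^ (k - i)) (hp0 _)
        (MvPowerSeries.map (rootTransition V p i k (hij.trans hjk)) x)
    rw [MvPowerSeries.map_expand, ← MvPowerSeries.expand_mul, ← RingHom.comp_apply,
      ← MvPowerSeries.map_comp, rootTransition_comp]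
    have h2 : ∀ (m n : ℕ) (hm : m ≠ 0) (hn : n ≠ 0), m = n → ∀ y : Level V p d k,
        MvPowerSeries.expand m hm y = MvPowerSeries.expand n hn y := by
      rintro m n hm hn rfl y
      rfl
    refine h2 _ _ _ _ ?_ _
    rw [← pow_add]
    congr 1
    omega

/-- The ring `R_∞ = ⋃_e R_e`, the union being formed as the direct limit of the tower `(R_e)`. -/
def RInf : Type u := DirectLimit (Level V p d) (levelTransition V p d)

instance : CommRing (RInf V p d) :=
  inferInstanceAs (CommRing (DirectLimit (Level V p d) (levelTransition V p d)))

/-- The canonical map `R_e → R_∞`. -/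
def ofLevel (e : ℕ) : Level V p d e →+* RInf V p d :=
  DirectLimit.Ring.of (Level V p d) (levelTransition V p d) e

/-- The canonical map `R = V[[x_2, …, x_d]] → R_∞`, through the identification of `R` with `R_0`. -/
def ofBase : MvPowerSeries (Fin (d - 1)) V →+* RInf V p d :=
  (ofLevel V p d 0).comp (MvPowerSeries.map (AdjoinRoot.of _))

end Tower

/-! ### Normalized length -/

section Length

variable (V : Type u) [CommRing V] (p d : ℕ) [Fact p.Prime]

/-- An `R_∞`-module is `𝔪`-torsion if each of its elements is annihilated by some power of the
maximal ideal `𝔪` of `R = V[[x_2, …, x_d]]`. -/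
def IsMTorsion [IsLocalRing V] (M : Type w) [AddCommGroup M] [Module (RInf V p d) M] : Prop :=
  ∀ m : M, ∃ k : ℕ, ∀ a ∈ IsLocalRing.maximalIdeal (MvPowerSeries (Fin (d - 1)) V) ^ k,
    ofBase V p d a • m = 0

/-- The cokernel of the map `A^b → A^a` given by an `a × b` matrix over `A`. -/
abbrev Coker {A : Type u} [CommRing A] {a b : ℕ} (φ : Matrix (Fin a) (Fin b) A) : Type u :=
  (Fin a → A) ⧸ LinearMap.range φ.mulVecLin

/-- The normalized length of a finitely presented `𝔪`-torsion module `M`. A presentation of `M` is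
defined over some `R_n` by a matrix `φ`; with `M_n` the cokernel of `φ` over `R_n`, the normalized
length is `ℓ(M_n) / p^{dn}`. This number does not depend on `n` and `φ`, so that the infimum over
all such data is their common value. -/
def lengthFP (M : Type w) [AddCommGroup M] [Module (RInf V p d) M] : ℝ≥0∞ :=
  ⨅ (n : ℕ) (a : ℕ) (b : ℕ) (φ : Matrix (Fin a) (Fin b) (Level V p d n))
    (_ : Nonempty (M ≃ₗ[RInf V p d] Coker (φ.map (ofLevel V p d n)))),
    (Module.length (Level V p d n) (Coker φ) : ℝ≥0∞) / (p : ℝ≥0∞) ^ (d * n)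

/-- The normalized length of a finitely generated `𝔪`-torsion module `M`: the infimum of the
normalized lengths of the finitely presented `𝔪`-torsion modules `N` that map onto `M`. (Every
finitely presented `R_∞`-module is isomorphic to one in the universe of `R_∞`.) -/
def lengthFG [IsLocalRing V] (M : Type w) [AddCommGroup M] [Module (RInf V p d) M] : ℝ≥0∞ :=
  ⨅ (N : Type u) (_ : AddCommGroup N) (_ : Module (RInf V p d) N)
    (_ : Module.FinitePresentation (RInf V p d) N) (_ : IsMTorsion V p d N)
    (_ : ∃ f : N →ₗ[RInf V p d] M, Function.Surjective f), lengthFP V p d N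

/-- The normalized length `λ_∞(M)` of an `𝔪`-torsion `R_∞`-module `M`: the supremum of the
normalized lengths of the finitely generated submodules of `M`. -/
def normalizedLength [IsLocalRing V] (M : Type w) [AddCommGroup M] [Module (RInf V p d) M] :
    ℝ≥0∞ :=
  ⨆ (N : Submodule (RInf V p d) M) (_ : N.FG), lengthFG V p d N

end Length

/-! ### Frobenius twist -/

section Twist

variable (A : Type u) [CommRing A] (p : ℕ) (M : Type w) [AddCommGroup M] [Module A M]

/-- The module `M^{[F]}` for an `A`-module `M` with `p M = 0`: the abelian group `M`, on which
`a ∈ A` acts as `a^p` does on `M`. -/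
@[nolint unusedArguments]
def FrobeniusTwist (_hM : ∀ m : M, (p : A) • m = 0) : Type w := M

variable {A p M} (hM : ∀ m : M, (p : A) • m = 0)

instance : AddCommGroup (FrobeniusTwist A p M hM) := inferInstanceAs (AddCommGroup M)

/-- The identity map `M → M^{[F]}`, an isomorphism of abelian groups. -/
def toTwist : M ≃+ FrobeniusTwist A p M hM := AddEquiv.refl M

instance [Fact p.Prime] : SMul A (FrobeniusTwist A p M hM) where
  smul a x := toTwist hM (a ^ p • (toTwist hM).symm x)

theorem smul_toTwist [Fact p.Prime] (a : A) (m : M) :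
    a • toTwist hM m = toTwist hM (a ^ p • m) := rfl

instance [Fact p.Prime] : Module A (FrobeniusTwist A p M hM) where
  one_smul x := by
    obtain ⟨m, rfl⟩ := (toTwist hM).surjective x
    rw [smul_toTwist, one_pow, one_smul]
  mul_smul a b x := by
    obtain ⟨m, rfl⟩ := (toTwist hM).surjective x
    rw [smul_toTwist, smul_toTwist, smul_toTwist, mul_pow, mul_smul]
  smul_zero a := by
    rw [← map_zero (toTwist hM), smul_toTwist, smul_zero]
  smul_add a x y := by
    obtain ⟨m, rfl⟩ := (toTwist hM).surjective x
    obtain ⟨n, rfl⟩ := (toTwist hM).surjective y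
    rw [← map_add, smul_toTwist, smul_toTwist, smul_toTwist, smul_add, map_add]
  add_smul a b x := by
    obtain ⟨m, rfl⟩ := (toTwist hM).surjective x
    obtain ⟨r, hr⟩ := exists_add_pow_prime_eq (Fact.out : p.Prime) a b
    have h0 : (p * a * b * r : A) • m = 0 := by
      rw [show (p * a * b * r : A) = (a * b * r) * p by ring, mul_smul, hM, smul_zero]
    rw [smul_toTwist, smul_toTwist, smul_toTwist, ← map_add, hr, add_smul, add_smul, h0, add_zero]
  zero_smul x := by
    obtain ⟨m, rfl⟩ := (toTwist hM).surjective x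
    rw [smul_toTwist, zero_pow (Fact.out : p.Prime).ne_zero, zero_smul, map_zero]

end Twist

end NormalizedLength

end

open NormalizedLength

/-! On power series modulo `p`, raising to the `p`-th power multiplies all exponents by `p` and
raises the coefficients to the `p`-th power. As `V/p` is perfect, Frobenius therefore induces an
isomorphism `R_{n+1}/p^{1/p} ≅ R_n/p`. It is used as the relation `FrobRel`: `y` in `R_{n+1}`
corresponds to `x` in `R_n` if `y^p ≡ x` modulo `p`.

Merging the two infima in the definition, `lengthFG_eq_iInf_covers` turns the length of a finitely
generated module `N` into one infimum of `ℓ(coker φ)/p^{dn}` over matrices `φ` over some `R_n` whose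
torsion cokernel over `R_∞` maps onto `N`. Let `pN = 0`. If `φ` over `R_n` and `ψ` over `R_{n+1}`
have corresponding entries, then `coker φ / p` and `coker ψ / p^{1/p}` correspond under Frobenius.
So if `φ` covers `N`, then `(ψ | p^{1/p})` covers the twist and is no longer than `φ`
(`Covers.twist`, `length_coker_augment_le_of_frobRel`); if `ψ` covers the twist, then `(φ | p)`
covers `N` and is no longer than `ψ` (`Covers.untwist`,
`length_coker_augment_natCast_le_of_frobRel`). The level differs by one, which accounts for the
factor `p^{-d}`. Inequalities suffice, so neither flatness of the tower nor independence of the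
presentation is needed.

A module and its twist have the same submodules, with the same ones finitely generated, so the
formula passes to the supremum. -/

noncomputable section

namespace NormalizedLength

/-! ### The Frobenius modulo `p` -/

section FrobMod

variable {A : Type*} [CommRing A] {B : Type*} [CommRing B] (p : ℕ) [Fact p.Prime]

/-- The ring homomorphism `A → A / pA`, `x ↦ x ^ p`. -/
def frobMod (A : Type*) [CommRing A] : A →+* A ⧸ Ideal.span {(p : A)} where
  toFun x := Ideal.Quotient.mk _ (x ^ p)
  map_one' := by rw [one_pow, map_one]
  map_zero' := by rw [zero_pow (Fact.out : p.Prime).ne_zero, map_zero]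
  map_mul' x y := by rw [mul_pow, map_mul]
  map_add' x y := by
    obtain ⟨r, hr⟩ := exists_add_pow_prime_eq (Fact.out : p.Prime) x y
    rw [hr, ← map_add, Ideal.Quotient.eq, add_sub_cancel_left, Ideal.mem_span_singleton]
    exact ⟨x * y * r, by ring⟩

theorem frobMod_apply (x : A) : frobMod p A x = Ideal.Quotient.mk _ (x ^ p) := rfl

theorem mk_eq_zero_iff_dvd {a x : A} : Ideal.Quotient.mk (Ideal.span {a}) x = 0 ↔ a ∣ x := by
  rw [Ideal.Quotient.eq_zero_iff_mem, Ideal.mem_span_singleton]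

theorem mk_eq_mk_iff_dvd {a x y : A} :
    Ideal.Quotient.mk (Ideal.span {a}) x = Ideal.Quotient.mk _ y ↔ a ∣ x - y := by
  rw [← sub_eq_zero, ← map_sub, mk_eq_zero_iff_dvd]

/-- The elements `x` and `y` of the source and the target of `f : A → B` correspond to each other
under Frobenius if `y ^ p` is congruent to `f x` modulo `p`. -/
def FrobRel (f : A →+* B) (y : B) (x : A) : Prop :=
  frobMod p B y = Ideal.Quotient.mk _ (f x)

variable {p} {f : A →+* B}

theorem FrobRel.add {y y' : B} {x x' : A} (h : FrobRel p f y x) (h' : FrobRel p f y' x') :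
    FrobRel p f (y + y') (x + x') := by
  unfold FrobRel at *
  rw [map_add, map_add, map_add, h, h']

theorem FrobRel.sub {y y' : B} {x x' : A} (h : FrobRel p f y x) (h' : FrobRel p f y' x') :
    FrobRel p f (y - y') (x - x') := by
  unfold FrobRel at *
  rw [map_sub, map_sub, map_sub, h, h']

theorem FrobRel.mul {y y' : B} {x x' : A} (h : FrobRel p f y x) (h' : FrobRel p f y' x') :
    FrobRel p f (y * y') (x * x') := by
  unfold FrobRel at *
  rw [map_mul, map_mul, map_mul, h, h']

theorem FrobRel.zero : FrobRel p f 0 0 := by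
  simp [FrobRel]

theorem FrobRel.mulVec {m n : Type*} [Fintype n] {M : Matrix m n B} {N : Matrix m n A}
    (h : ∀ i j, FrobRel p f (M i j) (N i j)) {v : n → B} {w : n → A}
    (hvw : ∀ j, FrobRel p f (v j) (w j)) (i : m) :
    FrobRel p f ((M.mulVec v) i) ((N.mulVec w) i) := by
  simp only [Matrix.mulVec, dotProduct, FrobRel, map_sum]
  exact Finset.sum_congr rfl fun j _ => (h i j).mul (hvw j)

end FrobMod

/-! ### The coefficient rings -/

section Coefficients

open Polynomial

/-- The quotient by a monic `g` is free over `V` on the powers of the root, and the coefficients of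
the reduced polynomial `h` are coordinates in this basis. -/
theorem natCast_dvd_mk_iff {V : Type*} [CommRing V] {g : V[X]} (hg : g.Monic) (q : ℕ)
    (h : V[X]) (hdeg : h %ₘ g = h) :
    (q : AdjoinRoot g) ∣ AdjoinRoot.mk g h ↔ ∀ j, (q : V) ∣ h.coeff j := by
  constructor
  · rintro ⟨z, hz⟩ j
    have h1 : h = (q : V) • AdjoinRoot.modByMonicHom hg z := by
      rw [← map_smul, Algebra.smul_def, map_natCast, ← hz, AdjoinRoot.modByMonicHom_mk, hdeg]
    rw [h1, coeff_smul, smul_eq_mul]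
    exact dvd_mul_right _ _
  · intro hj
    obtain ⟨h', rfl⟩ := (Polynomial.C_dvd_iff_dvd_coeff _ _).mpr hj
    exact ⟨AdjoinRoot.mk g h', by simp⟩

variable (V : Type u) [CommRing V] (p : ℕ)

theorem rootTransition_succ_mk (e : ℕ) (h : V[X]) :
    rootTransition V p e (e + 1) e.le_succ (AdjoinRoot.mk _ h) =
      AdjoinRoot.mk _ (expand V p h) := by
  induction h using Polynomial.induction_on' with
  | add f g hf hg => simp only [map_add, hf, hg]
  | monomial n a =>
    rw [← C_mul_X_pow_eq_monomial]
    simp only [map_mul, map_pow, expand_C, expand_X, AdjoinRoot.mk_C, AdjoinRoot.mk_X,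
      rootTransition_of]
    change _ * (rootTransition V p e (e + 1) _ (pRoot V p e)) ^ n = _
    rw [rootTransition_pRoot, Nat.add_sub_cancel_left, pow_one]
    rfl

theorem pRoot_succ_pow_prime (e : ℕ) :
    pRoot V p (e + 1) ^ p = rootTransition V p e (e + 1) e.le_succ (pRoot V p e) := by
  rw [rootTransition_pRoot, Nat.add_sub_cancel_left, pow_one]

theorem induction_rootRing {e : ℕ} {P : RootRing V p e → Prop} (x : RootRing V p e)
    (add : ∀ a b, P a → P b → P (a + b)) (mul : ∀ a b, P a → P b → P (a * b))
    (of : ∀ v, P (AdjoinRoot.of _ v)) (root : P (pRoot V p e)) : P x := by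
  obtain ⟨h, rfl⟩ := AdjoinRoot.mk_surjective x
  have hpow : ∀ n, P (pRoot V p e ^ n) := by
    intro n
    induction n with
    | zero => simpa using of 1
    | succ n ih => rw [pow_succ]; exact mul _ _ ih root
  induction h using Polynomial.induction_on' with
  | add f g hf hg => rw [map_add]; exact add _ _ hf hg
  | monomial n a =>
    rw [← C_mul_X_pow_eq_monomial, map_mul, map_pow, AdjoinRoot.mk_C, AdjoinRoot.mk_X]
    exact mul _ _ (of a) (hpow n)

variable [Fact p.Prime]

theorem monic_X_pow_sub_natCast (e : ℕ) : (X ^ (p ^ e) - C (p : V)).Monic :=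
  monic_X_pow_sub_C _ (pow_ne_zero _ (Fact.out : p.Prime).ne_zero)

theorem modByMonic_eq_of_natDegree_lt [Nontrivial V] (e : ℕ) {h : V[X]}
    (hh : h.natDegree < p ^ e) :
    h %ₘ (X ^ (p ^ e) - C (p : V)) = h := by
  rw [modByMonic_eq_self_iff (monic_X_pow_sub_natCast V p e)]
  refine degree_lt_degree ?_
  rwa [natDegree_X_pow_sub_C]

/-- This is injectivity of `V_e/p → V_{e+1}/p`. Replacing `T` by `T^p` keeps a reduced
representative reduced, with the same nonzero coefficients. -/
theorem natCast_dvd_of_natCast_dvd_rootTransition [Nontrivial V] (e : ℕ) (x : RootRing V p e)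
    (hx : (p : RootRing V p (e + 1)) ∣ rootTransition V p e (e + 1) e.le_succ x) :
    (p : RootRing V p e) ∣ x := by
  obtain ⟨h, rfl⟩ := AdjoinRoot.mk_surjective x
  have hp0 := (Fact.out : p.Prime).pos
  set g := (X ^ (p ^ e) - C (p : V)) with hg
  have hm : g.Monic := monic_X_pow_sub_natCast V p e
  obtain ⟨h, hdeg, hh⟩ : ∃ h' : V[X], h'.natDegree < p ^ e ∧
      AdjoinRoot.mk g h = AdjoinRoot.mk g h' := by
    refine ⟨h %ₘ g, ?_, ?_⟩
    · have := natDegree_modByMonic_lt h hm (by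
        intro h1
        have := congrArg natDegree h1
        rw [natDegree_X_pow_sub_C, natDegree_one] at this
        exact (pow_pos hp0 e).ne' this)
      rwa [natDegree_X_pow_sub_C] at this
    · exact (AdjoinRoot.mk_leftInverse hm (AdjoinRoot.mk g h)).symm
  rw [hh] at hx ⊢
  rw [rootTransition_succ_mk, natCast_dvd_mk_iff (monic_X_pow_sub_natCast V p (e + 1))] at hx
  · rw [natCast_dvd_mk_iff hm _ _ (modByMonic_eq_of_natDegree_lt V p e hdeg)]
    intro j
    have := hx (j * p)
    rwa [coeff_expand_mul hp0] at this
  · refine modByMonic_eq_of_natDegree_lt V p _ ?_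
    rw [natDegree_expand, pow_succ]
    exact Nat.mul_lt_mul_of_pos_right hdeg hp0

/-- The relation respects sums and products, so generators suffice: `v` corresponds to `v^p` and
`p^{1/p^{e+1}}` to `p^{1/p^e}`. -/
theorem exists_frobRel_rootRing_right {e : ℕ} (y : RootRing V p (e + 1)) :
    ∃ x, FrobRel p (rootTransition V p e (e + 1) e.le_succ) y x := by
  induction y using induction_rootRing with
  | add a b ha hb =>
    obtain ⟨x, hx⟩ := ha
    obtain ⟨x', hx'⟩ := hb
    exact ⟨_, hx.add hx'⟩
  | mul a b ha hb =>
    obtain ⟨x, hx⟩ := ha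
    obtain ⟨x', hx'⟩ := hb
    exact ⟨_, hx.mul hx'⟩
  | of v =>
    refine ⟨AdjoinRoot.of _ (v ^ p), ?_⟩
    rw [FrobRel, rootTransition_of, frobMod_apply, map_pow (AdjoinRoot.of _)]
  | root =>
    refine ⟨pRoot V p e, ?_⟩
    rw [FrobRel, ← pRoot_succ_pow_prime, frobMod_apply]

variable {V p} in
theorem exists_frobRel_rootRing_left (hV : ∀ v : V, ∃ w, (p : V) ∣ w ^ p - v) {e : ℕ}
    (x : RootRing V p e) :
    ∃ y, FrobRel p (rootTransition V p e (e + 1) e.le_succ) y x := by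
  induction x using induction_rootRing with
  | add a b ha hb =>
    obtain ⟨x, hx⟩ := ha
    obtain ⟨x', hx'⟩ := hb
    exact ⟨_, hx.add hx'⟩
  | mul a b ha hb =>
    obtain ⟨x, hx⟩ := ha
    obtain ⟨x', hx'⟩ := hb
    exact ⟨_, hx.mul hx'⟩
  | of v =>
    obtain ⟨w, hw⟩ := hV v
    refine ⟨AdjoinRoot.of _ w, ?_⟩
    rw [FrobRel, rootTransition_of, frobMod_apply, mk_eq_mk_iff_dvd, ← map_pow, ← map_sub]
    simpa using map_dvd (AdjoinRoot.of (X ^ (p ^ (e + 1)) - C (p : V))) hw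
  | root =>
    refine ⟨pRoot V p (e + 1), ?_⟩
    rw [FrobRel, ← pRoot_succ_pow_prime, frobMod_apply]

variable {V p} in
-- The kernel of Frobenius on `V_{e+1}/p` is generated by `p^{1/p}`: modulo this element only
-- degrees below `p^e` remain, and there Frobenius is injective because `V/p` is reduced.
theorem pRoot_pow_dvd_of_frobMod_eq_zero [Nontrivial V]
    (hV : ∀ v : V, (p : V) ∣ v ^ p → (p : V) ∣ v) {e : ℕ}
    (y : RootRing V p (e + 1)) (hy : frobMod p _ y = 0) : pRoot V p (e + 1) ^ p ^ e ∣ y := by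
  have hp0 := (Fact.out : p.Prime).pos
  obtain ⟨h, rfl⟩ := AdjoinRoot.mk_surjective y
  set G := (X ^ (p ^ (e + 1)) - C (p : V)) with hG
  -- `h₀` is the part of `h` of degree less than `p ^ e`
  obtain ⟨h₀, h₁, hdeg, hh⟩ : ∃ h₀ h₁ : V[X], h₀.natDegree < p ^ e ∧ h = h₀ + X ^ p ^ e * h₁ := by
    refine ⟨h %ₘ X ^ p ^ e, h /ₘ X ^ p ^ e, ?_, (modByMonic_add_div _ _).symm⟩
    have := natDegree_modByMonic_lt h (monic_X_pow (R := V) (p ^ e)) (by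
        intro h1
        have := congrArg natDegree h1
        rw [natDegree_X_pow, natDegree_one] at this
        exact (pow_pos hp0 e).ne' this)
    rwa [natDegree_X_pow] at this
  have hpi : AdjoinRoot.mk G (X ^ p ^ e) = pRoot V p (e + 1) ^ p ^ e := by
    rw [map_pow, AdjoinRoot.mk_X]
    rfl
  have h0 : frobMod p _ (AdjoinRoot.mk G h₀) = 0 := by
    have h2 : frobMod p _ (pRoot V p (e + 1) ^ p ^ e) = 0 := by
      rw [frobMod_apply, ← pow_mul, ← pow_succ, pRoot_pow, mk_eq_zero_iff_dvd]
    rwa [hh, map_add, map_mul, hpi, map_add, map_mul, h2, zero_mul, add_zero] at hy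
  rw [hh, map_add, map_mul, hpi]
  refine dvd_add ?_ (dvd_mul_right _ _)
  have hp_dvd : pRoot V p (e + 1) ^ p ^ e ∣ (p : RootRing V p (e + 1)) := by
    rw [← pRoot_pow]
    exact pow_dvd_pow _ (Nat.pow_le_pow_right hp0 e.le_succ)
  refine hp_dvd.trans ?_
  have hlt : p ^ e ≤ p ^ (e + 1) := Nat.pow_le_pow_right hp0 e.le_succ
  refine (natCast_dvd_mk_iff (monic_X_pow_sub_natCast V p (e + 1)) _ _
    (modByMonic_eq_of_natDegree_lt V p _ (hdeg.trans_le hlt))).mpr fun j => hV _ ?_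
  -- the polynomial whose coefficients are the `p`-th powers of those of `h₀`
  set k : V[X] := ∑ i ∈ Finset.range (p ^ e), C (h₀.coeff i ^ p) * X ^ i with hk
  have hkdeg : k.natDegree < p ^ e := by
    rw [Nat.lt_iff_le_pred (pow_pos hp0 e)]
    refine natDegree_sum_le_of_forall_le _ _ fun i hi => (natDegree_C_mul_X_pow_le _ _).trans ?_
    have := Finset.mem_range.mp hi
    exact Nat.le_pred_of_lt this
  have hkc : k.coeff j = h₀.coeff j ^ p := by
    rw [hk, finsetSum_coeff]
    simp only [coeff_C_mul_X_pow]
    rw [Finset.sum_ite_eq]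
    split_ifs with hj
    · rfl
    · rw [coeff_eq_zero_of_natDegree_lt, zero_pow hp0.ne']
      exact hdeg.trans_le (not_lt.mp fun h => hj (Finset.mem_range.mpr h))
  -- Frobenius is additive modulo `p`, so the `p`-th power of `∑ cᵢ Tⁱ` is `∑ cᵢ^p T^{ip}`, the
  -- image of `k`.
  have hrel : FrobRel p (rootTransition V p e (e + 1) e.le_succ) (AdjoinRoot.mk G h₀)
      (AdjoinRoot.mk _ k) := by
    rw [FrobRel, rootTransition_succ_mk, hk]
    conv_lhs => rw [h₀.as_sum_range' (p ^ e) hdeg]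
    simp only [map_sum, map_mul, map_pow, expand_C, expand_X, ← C_mul_X_pow_eq_monomial,
      frobMod_apply]
    refine Finset.sum_congr rfl fun i _ => ?_
    rw [← pow_mul]
  rw [FrobRel, h0, eq_comm, mk_eq_zero_iff_dvd] at hrel
  have := natCast_dvd_of_natCast_dvd_rootTransition V p e _ hrel
  rw [natCast_dvd_mk_iff (monic_X_pow_sub_natCast V p e) _ _
    (modByMonic_eq_of_natDegree_lt V p e hkdeg)] at this
  exact hkc ▸ this j

end Coefficients

/-! ### The power series rings -/

section PowerSeries

theorem exists_forall_coeff_eq {σ A : Type*} [CommRing A] (c : (σ →₀ ℕ) → A) :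
    ∃ f : MvPowerSeries σ A, ∀ m, MvPowerSeries.coeff m f = c m :=
  ⟨c, fun _ => rfl⟩

theorem C_dvd_iff_forall_coeff {σ A : Type*} [CommRing A] (a : A) (f : MvPowerSeries σ A) :
    MvPowerSeries.C a ∣ f ↔ ∀ m, a ∣ MvPowerSeries.coeff m f := by
  constructor
  · rintro ⟨g, rfl⟩ m
    rw [MvPowerSeries.coeff_C_mul]
    exact dvd_mul_right _ _
  · intro h
    choose g hg using h
    obtain ⟨G, hG⟩ := exists_forall_coeff_eq g
    refine ⟨G, MvPowerSeries.ext fun m => ?_⟩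
    rw [MvPowerSeries.coeff_C_mul, hg, hG]

theorem natCast_dvd_iff_map_mk_eq_zero {σ A : Type*} [CommRing A] (q : ℕ)
    (f : MvPowerSeries σ A) :
    (q : MvPowerSeries σ A) ∣ f ↔
      MvPowerSeries.map (Ideal.Quotient.mk (Ideal.span {(q : A)})) f = 0 := by
  rw [← map_natCast MvPowerSeries.C q, C_dvd_iff_forall_coeff, MvPowerSeries.ext_iff]
  refine forall_congr' fun m => ?_
  rw [MvPowerSeries.coeff_map, map_zero, mk_eq_zero_iff_dvd]

theorem expand_injective {σ A : Type*} [CommRing A] (q : ℕ) (hq : q ≠ 0) :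
    Function.Injective (MvPowerSeries.expand (σ := σ) (R := A) q hq) := by
  intro f g h
  ext m
  rw [← MvPowerSeries.coeff_expand_smul q hq, h, MvPowerSeries.coeff_expand_smul]

theorem pow_prime_eq_expand_map_pow {σ S : Type*} [CommRing S] (p : ℕ) [Fact p.Prime]
    (hp : (p : S) = 0) (F : S →+* S) (hF : ∀ s, F s = s ^ p) (f : MvPowerSeries σ S) :
    f ^ p = MvPowerSeries.expand p (Fact.out : p.Prime).ne_zero (MvPowerSeries.map F f) := by
  -- The zero ring does not have characteristic `p` and is treated apart.
  cases subsingleton_or_nontrivial S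
  · exact MvPowerSeries.ext fun m => Subsingleton.elim _ _
  · have : CharP S p := (CharP.charP_iff_prime_eq_zero Fact.out).mpr hp
    have h2 : F = frobenius S p := RingHom.ext fun s => by rw [hF, frobenius_def]
    rw [h2, ← MvPowerSeries.map_frobenius_expand, MvPowerSeries.map_expand]

variable (V : Type u) [CommRing V] (p d : ℕ) [Fact p.Prime]

/-- The transition map between consecutive levels. -/
abbrev nextLevel (n : ℕ) : Level V p d n →+* Level V p d (n + 1) :=
  levelTransition V p d n (n + 1) n.le_succ

theorem nextLevel_apply (n : ℕ) (f : Level V p d n) :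
    nextLevel V p d n f = MvPowerSeries.expand p (Fact.out : p.Prime).ne_zero
      (MvPowerSeries.map (rootTransition V p n (n + 1) n.le_succ) f) := by
  have h2 : ∀ (m k : ℕ) (hm : m ≠ 0) (hk : k ≠ 0), m = k → ∀ y : Level V p d (n + 1),
      MvPowerSeries.expand m hm y = MvPowerSeries.expand k hk y := by
    rintro m k hm hk rfl y
    rfl
  exact h2 _ _ (pow_ne_zero _ (Fact.out : p.Prime).ne_zero) _
    (by rw [Nat.add_sub_cancel_left, pow_one]) _

variable {V p d}

theorem map_mk_pow_eq_expand_map_frobMod {σ A : Type*} [CommRing A] (f : MvPowerSeries σ A) :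
    MvPowerSeries.map (Ideal.Quotient.mk (Ideal.span {(p : A)})) (f ^ p) =
      MvPowerSeries.expand p (Fact.out : p.Prime).ne_zero (MvPowerSeries.map (frobMod p A) f) := by
  have hp0 : (p : A ⧸ Ideal.span {(p : A)}) = 0 := by
    rw [← map_natCast (Ideal.Quotient.mk (Ideal.span {(p : A)})), mk_eq_zero_iff_dvd]
  let F : (A ⧸ Ideal.span {(p : A)}) →+* (A ⧸ Ideal.span {(p : A)}) :=
    Ideal.Quotient.lift _ (frobMod p A) (by
      intro a ha
      rw [Ideal.mem_span_singleton] at ha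
      rw [frobMod_apply, mk_eq_zero_iff_dvd]
      exact dvd_pow ha (Fact.out : p.Prime).ne_zero)
  have hF : ∀ s, F s = s ^ p := by
    intro s
    obtain ⟨s, rfl⟩ := Ideal.Quotient.mk_surjective s
    rw [Ideal.Quotient.lift_mk, frobMod_apply, map_pow]
  rw [map_pow, pow_prime_eq_expand_map_pow p hp0 F hF, ← RingHom.comp_apply,
    ← MvPowerSeries.map_comp]
  rfl

/-- Modulo `p`, the `p`-th power and the transition map both factor through the same injective
`expand p`; cancelling it leaves a condition on each coefficient. -/
theorem frobRel_nextLevel_iff {n : ℕ} {f : Level V p d (n + 1)} {g : Level V p d n} :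
    FrobRel p (nextLevel V p d n) f g ↔ ∀ m, FrobRel p (rootTransition V p n (n + 1) n.le_succ)
      (MvPowerSeries.coeff m f) (MvPowerSeries.coeff m g) := by
  rw [FrobRel, frobMod_apply, mk_eq_mk_iff_dvd, natCast_dvd_iff_map_mk_eq_zero, map_sub,
    map_mk_pow_eq_expand_map_frobMod, nextLevel_apply, MvPowerSeries.map_expand, sub_eq_zero,
    (expand_injective _ _).eq_iff, MvPowerSeries.ext_iff]
  rfl

theorem exists_frobRel_right (n : ℕ) (f : Level V p d (n + 1)) :
    ∃ g, FrobRel p (nextLevel V p d n) f g := by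
  choose g hg using fun m => exists_frobRel_rootRing_right V p (MvPowerSeries.coeff m f)
  exact ⟨g, frobRel_nextLevel_iff.mpr hg⟩

theorem exists_frobRel_left (hV : ∀ v : V, ∃ w, (p : V) ∣ w ^ p - v) (n : ℕ) (g : Level V p d n) :
    ∃ f, FrobRel p (nextLevel V p d n) f g := by
  choose f hf using fun m => exists_frobRel_rootRing_left hV (MvPowerSeries.coeff m g)
  exact ⟨f, frobRel_nextLevel_iff.mpr hf⟩

variable (V p d) in
/-- The element `p^{1/p}`, as an element of `R_{n+1}`. -/
def pthRoot (n : ℕ) : Level V p d (n + 1) :=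
  MvPowerSeries.C (pRoot V p (n + 1) ^ p ^ n)

theorem pthRoot_dvd_of_frobMod_eq_zero [Nontrivial V] (hV : ∀ v : V, (p : V) ∣ v ^ p → (p : V) ∣ v)
    {n : ℕ} (f : Level V p d (n + 1)) (hf : frobMod p _ f = 0) : pthRoot V p d n ∣ f := by
  rw [pthRoot, C_dvd_iff_forall_coeff]
  intro m
  refine pRoot_pow_dvd_of_frobMod_eq_zero hV _ ?_
  have : FrobRel p (nextLevel V p d n) f 0 := by
    rw [FrobRel, hf, map_zero, map_zero]
  have := frobRel_nextLevel_iff.mp this m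
  rwa [FrobRel, map_zero, map_zero, map_zero] at this

theorem natCast_dvd_of_natCast_dvd_nextLevel [Nontrivial V] {n : ℕ} (g : Level V p d n)
    (hg : (p : Level V p d (n + 1)) ∣ nextLevel V p d n g) : (p : Level V p d n) ∣ g := by
  rw [← map_natCast MvPowerSeries.C p, C_dvd_iff_forall_coeff]
  intro m
  refine natCast_dvd_of_natCast_dvd_rootTransition V p n _ ?_
  have : FrobRel p (nextLevel V p d n) 0 g := by
    rwa [FrobRel, map_zero, eq_comm, mk_eq_zero_iff_dvd]
  have := frobRel_nextLevel_iff.mp this m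
  rwa [FrobRel, map_zero, map_zero, eq_comm, mk_eq_zero_iff_dvd] at this

end PowerSeries

/-! ### The limit ring -/

section Limit

variable {V : Type u} [CommRing V] {p d : ℕ} [Fact p.Prime]

theorem ofLevel_levelTransition {i j : ℕ} (h : i ≤ j) (x : Level V p d i) :
    ofLevel V p d j (levelTransition V p d i j h x) = ofLevel V p d i x :=
  DirectLimit.Ring.of_f (G := Level V p d) (f := levelTransition V p d) h x

theorem exists_ofLevel (x : RInf V p d) : ∃ n y, x = ofLevel V p d n y :=
  DirectLimit.exists_eq_mk (levelTransition V p d) x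

theorem exists_levelTransition_eq_of_ofLevel_eq {i j : ℕ} {x : Level V p d i} {y : Level V p d j}
    (h : ofLevel V p d i x = ofLevel V p d j y) : ∃ (k : ℕ) (hi : i ≤ k) (hj : j ≤ k),
      levelTransition V p d i k hi x = levelTransition V p d j k hj y := by
  obtain ⟨k, hi, hj, h⟩ := Quotient.exact h
  exact ⟨k, hi, hj, h⟩

/-- In `R_∞` both levels lie in one ring, so the relation becomes the plain congruence `y^p ≡ x`
modulo `p`. -/
theorem FrobRel.ofLevel {n : ℕ} {f : Level V p d (n + 1)} {g : Level V p d n}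
    (h : FrobRel p (nextLevel V p d n) f g) :
    FrobRel p (RingHom.id (RInf V p d)) (ofLevel V p d (n + 1) f) (ofLevel V p d n g) := by
  rw [FrobRel, frobMod_apply, mk_eq_mk_iff_dvd] at *
  rw [RingHom.id_apply, ← ofLevel_levelTransition n.le_succ g, ← map_pow, ← map_sub]
  simpa using map_dvd (NormalizedLength.ofLevel V p d (n + 1)) h

theorem exists_frobRel_RInf (hV : ∀ v : V, ∃ w, (p : V) ∣ w ^ p - v) (c : RInf V p d) :
    ∃ s, FrobRel p (RingHom.id (RInf V p d)) s c := by
  obtain ⟨n, y, rfl⟩ := exists_ofLevel c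
  obtain ⟨f, hf⟩ := exists_frobRel_left hV n y
  exact ⟨_, hf.ofLevel⟩

theorem levelTransition_C {i j : ℕ} (h : i ≤ j) (a : RootRing V p i) :
    levelTransition V p d i j h (MvPowerSeries.C a) =
      MvPowerSeries.C (rootTransition V p i j h a) := by
  change MvPowerSeries.expand (p ^ (j - i)) (pow_ne_zero _ (Fact.out : p.Prime).ne_zero)
    (MvPowerSeries.map (rootTransition V p i j h) (MvPowerSeries.C a)) = _
  rw [MvPowerSeries.map_C, MvPowerSeries.expand_C]

theorem ofLevel_pthRoot {n m : ℕ} (h : n ≤ m) :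
    ofLevel V p d (n + 1) (pthRoot V p d n) = ofLevel V p d (m + 1) (pthRoot V p d m) := by
  rw [← ofLevel_levelTransition (Nat.succ_le_succ h), pthRoot, pthRoot, levelTransition_C, map_pow,
    rootTransition_pRoot, ← pow_mul, ← pow_add]
  congr 5
  omega

theorem pthRoot_dvd_of_frobMod_eq_zero_RInf [Nontrivial V]
    (hV : ∀ v : V, (p : V) ∣ v ^ p → (p : V) ∣ v) (n : ℕ) (z : RInf V p d)
    (hz : frobMod p _ z = 0) : ofLevel V p d (n + 1) (pthRoot V p d n) ∣ z := by
  rw [frobMod_apply, mk_eq_zero_iff_dvd] at hz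
  obtain ⟨w, hw⟩ := hz
  obtain ⟨i, z, rfl⟩ := exists_ofLevel z
  obtain ⟨j, w, rfl⟩ := exists_ofLevel w
  rw [← map_pow, ← map_natCast (ofLevel V p d j), ← map_mul] at hw
  obtain ⟨k, hi, hj, h⟩ := exists_levelTransition_eq_of_ofLevel_eq hw
  -- At level `m + 1` the equation `z^p = p w` already holds and `p^{1/p}` is available.
  set m := max k n
  have hk : k ≤ m + 1 := (le_max_left k n).trans (Nat.le_succ _)
  have hzm : frobMod p _ (levelTransition V p d i (m + 1) (hi.trans hk) z) = 0 := by
    rw [frobMod_apply, mk_eq_zero_iff_dvd, ← map_pow,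
      ← DirectedSystem.map_map (f := (levelTransition V p d · · ·)) hi hk, h,
      DirectedSystem.map_map (f := (levelTransition V p d · · ·)) hj hk, map_mul]
    exact Dvd.intro _ (congrArg (· * _) (map_natCast (levelTransition V p d j (m + 1) _) p).symm)
  rw [← ofLevel_levelTransition (hi.trans hk), ofLevel_pthRoot (le_max_right k n)]
  exact map_dvd _ (pthRoot_dvd_of_frobMod_eq_zero hV _ hzm)

theorem frobMod_ofLevel_pthRoot (n : ℕ) :
    frobMod p _ (ofLevel V p d (n + 1) (pthRoot V p d n)) = 0 := by
  have h : pthRoot V p d n ^ p = (p : Level V p d (n + 1)) := by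
    rw [pthRoot, ← map_pow, ← pow_mul, ← pow_succ, pRoot_pow]
    exact map_natCast MvPowerSeries.C p
  rw [frobMod_apply, ← map_pow, h, mk_eq_zero_iff_dvd]
  exact dvd_of_eq (map_natCast (ofLevel V p d (n + 1)) p).symm

end Limit

/-! ### Consequences of the residue field `V/p` being perfect -/

section Perfect

variable {V : Type u} [CommRing V] [IsLocalRing V] (p : ℕ)

theorem natCast_dvd_of_dvd_pow (hp : IsLocalRing.maximalIdeal V = Ideal.span {(p : V)}) {n : ℕ}
    (v : V) (hv : (p : V) ∣ v ^ n) : (p : V) ∣ v := by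
  rw [← Ideal.mem_span_singleton, ← hp] at *
  exact Ideal.IsPrime.mem_of_pow_mem inferInstance _ hv

variable [Fact p.Prime]

theorem charP_residueField (hp : IsLocalRing.maximalIdeal V = Ideal.span {(p : V)}) :
    CharP (IsLocalRing.ResidueField V) p := by
  refine (CharP.charP_iff_prime_eq_zero Fact.out).mpr ?_
  rw [← map_natCast (IsLocalRing.residue V), IsLocalRing.residue_eq_zero_iff, hp]
  exact Ideal.mem_span_singleton_self _

theorem exists_natCast_dvd_pow_sub (hp : IsLocalRing.maximalIdeal V = Ideal.span {(p : V)})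
    [PerfectField (IsLocalRing.ResidueField V)] (v : V) : ∃ w, (p : V) ∣ w ^ p - v := by
  have := charP_residueField p hp
  obtain ⟨w, hw⟩ := surjective_frobenius (IsLocalRing.ResidueField V) p (IsLocalRing.residue V v)
  obtain ⟨w, rfl⟩ := IsLocalRing.residue_surjective w
  refine ⟨w, ?_⟩
  rw [← Ideal.mem_span_singleton, ← hp, ← IsLocalRing.residue_eq_zero_iff, map_sub, map_pow,
    sub_eq_zero, ← hw, frobenius_def]

end Perfect

/-! ### Comparison of lengths -/

section GeneralLength

/-- Length is the Krull dimension of the lattice of submodules, so it can be compared across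
different rings. -/
theorem length_le_of_strictMono {R S M N : Type*} [Ring R] [Ring S] [AddCommGroup M] [Module R M]
    [AddCommGroup N] [Module S N] (f : Submodule R M → Submodule S N) (hf : StrictMono f) :
    Module.length R M ≤ Module.length S N := by
  rw [← WithBot.coe_le_coe, Module.coe_length, Module.coe_length]
  exact Order.krullDim_le_of_strictMono f hf

theorem length_le_of_surjective_semilinear {R S M N : Type*} [Ring R] [Ring S] [AddCommGroup M]
    [Module R M] [AddCommGroup N] [Module S N] {σ : R →+* S} (f : M →ₛₗ[σ] N)
    (hf : Function.Surjective f) : Module.length S N ≤ Module.length R M :=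
  length_le_of_strictMono (Submodule.comap f) <|
    Monotone.strictMono_of_injective (fun _ _ h => Submodule.comap_mono h) fun K L h => by
      ext n
      obtain ⟨m, rfl⟩ := hf n
      exact SetLike.ext_iff.mp h m

/-- If `M` and `N` are modules over `R` and `S`, then an additive relation between `M` and `N` that
is defined on all of `M`, injective, and compatible with scalars in the sense that the action of
each `s` is matched by that of some `r`, bounds the length of `M` by that of `N`. -/
theorem length_le_of_rel {R S M N : Type*} [Ring R] [Ring S] [AddCommGroup M] [Module R M]
    [AddCommGroup N] [Module S N] (r : M → N → Prop) (zero : r 0 0)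
    (add : ∀ m n m' n', r m n → r m' n' → r (m + m') (n + n'))
    (sub : ∀ m n m' n', r m n → r m' n' → r (m - m') (n - n'))
    (smul : ∀ s : S, ∃ t : R, ∀ m n, r m n → r (t • m) (s • n))
    (total : ∀ m, ∃ n, r m n) (inj : ∀ m, r m 0 → m = 0) :
    Module.length R M ≤ Module.length S N := by
  let f : Submodule R M → Submodule S N := fun K =>
    { carrier := {n | ∃ m ∈ K, r m n}
      zero_mem' := ⟨0, K.zero_mem, zero⟩
      add_mem' := by
        rintro _ _ ⟨m, hm, hr⟩ ⟨m', hm', hr'⟩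
        exact ⟨_, K.add_mem hm hm', add _ _ _ _ hr hr'⟩
      smul_mem' := by
        rintro s _ ⟨m, hm, hr⟩
        obtain ⟨t, ht⟩ := smul s
        exact ⟨_, K.smul_mem t hm, ht _ _ hr⟩ }
  have hmono : Monotone f := fun K L h n ⟨m, hm, hr⟩ => ⟨m, h hm, hr⟩
  have hle : ∀ K L, f K ≤ f L → K ≤ L := by
    intro K L h m hm
    obtain ⟨n, hn⟩ := total m
    obtain ⟨m', hm', hn'⟩ := h (show n ∈ f K from ⟨m, hm, hn⟩)
    -- Both `m` and `m'` are related to the same `n`, hence `m - m'` is related to `0`.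
    have := inj (m - m') (by simpa using sub _ _ _ _ hn hn')
    rw [sub_eq_zero.mp this]
    exact hm'
  exact length_le_of_strictMono f (hmono.strictMono_of_injective fun K L h =>
    le_antisymm (hle _ _ h.le) (hle _ _ h.ge))

end GeneralLength

/-! ### Cokernels of matrices -/

section Cokernel

variable {A : Type u} [CommRing A] {B : Type u} [CommRing B] {a b : ℕ}

/-- The matrix `(φ | t)` obtained from `φ` by adding the columns of the scalar matrix `t`. -/
def augment (φ : Matrix (Fin a) (Fin b) A) (t : A) : Matrix (Fin a) (Fin (b + a)) A :=
  Matrix.of fun i j => Fin.addCases (fun j => φ i j) (fun k => if i = k then t else 0) j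

theorem augment_mulVec (φ : Matrix (Fin a) (Fin b) A) (t : A) (v : Fin (b + a) → A) :
    (augment φ t).mulVec v =
      φ.mulVec (fun j => v (Fin.castAdd a j)) + t • fun k => v (Fin.natAdd b k) := by
  ext i
  simp [augment, Matrix.mulVec, dotProduct, Fin.sum_univ_add]

/-- Consequently the cokernel of `augment φ t` is that of `φ` modulo `t`. -/
theorem mem_range_augment {φ : Matrix (Fin a) (Fin b) A} {t : A} {x : Fin a → A} :
    x ∈ LinearMap.range (augment φ t).mulVecLin ↔ ∃ v w, x = φ.mulVec v + t • w := by
  constructor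
  · rintro ⟨v, rfl⟩
    exact ⟨_, _, augment_mulVec φ t v⟩
  · rintro ⟨v, w, rfl⟩
    refine ⟨Fin.append v w, ?_⟩
    rw [Matrix.mulVecLin_apply, augment_mulVec]
    simp

theorem augment_map (f : A →+* B) (φ : Matrix (Fin a) (Fin b) A) (t : A) :
    (augment φ t).map f = augment (φ.map f) (f t) := by
  ext i j
  induction j using Fin.addCases with
  | left j => simp [augment]
  | right j => simp [augment, apply_ite f]

/-- If `B` is generated by the family `g` as an `A`-module, then the cokernel of a matrix over `B`
that comes from `A` is bounded in length by the cokernel over `A`. -/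
theorem length_coker_map_le (f : A →+* B) {κ : Type*} [Fintype κ] (g : κ → B)
    (hg : ∀ y, ∃ c : κ → A, y = ∑ k, f (c k) * g k) (φ : Matrix (Fin a) (Fin b) A) :
    Module.length B (Coker (φ.map f)) ≤ Fintype.card κ * Module.length A (Coker φ) := by
  have hφ : ∀ v : Fin b → A, (fun i => f (φ.mulVec v i)) = (φ.map f).mulVec (fun j => f (v j)) := by
    intro v
    ext i
    simp [Matrix.mulVec, dotProduct]
  let F₀ : (Fin a → A) →ₛₗ[f] (Fin a → B) :=
    { toFun := fun x i => f (x i)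
      map_add' := fun x y => by ext; simp
      map_smul' := fun c x => by ext; simp }
  let F : Coker φ →ₛₗ[f] Coker (φ.map f) := Submodule.liftQ _ ((Submodule.mkQ _).comp F₀) (by
    rintro _ ⟨v, rfl⟩
    refine (Submodule.Quotient.mk_eq_zero _).mpr ⟨fun j => f (v j), ?_⟩
    exact (hφ v).symm)
  let G : (κ → Coker φ) →ₛₗ[f] Coker (φ.map f) :=
    { toFun := fun x => ∑ k, g k • F (x k)
      map_add' := fun x y => by simp [Finset.sum_add_distrib]
      map_smul' := fun c x => by
        simp only [Pi.smul_apply, map_smulₛₗ, Finset.smul_sum]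
        exact Finset.sum_congr rfl fun k _ => smul_comm _ _ _ }
  have hG : Function.Surjective G := by
    intro z
    obtain ⟨y, rfl⟩ := Submodule.Quotient.mk_surjective _ z
    choose c hc using fun i => hg (y i)
    refine ⟨fun k => Submodule.Quotient.mk fun i => c i k, ?_⟩
    have hy : y = ∑ k, g k • F₀ (fun i => c i k) := by
      ext i
      rw [hc i, Finset.sum_apply]
      exact Finset.sum_congr rfl fun k _ => mul_comm _ _
    rw [hy, ← Submodule.mkQ_apply, map_sum]
    rfl
  refine (length_le_of_surjective_semilinear G hG).trans ?_
  rw [Module.length_pi]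
  simp

end Cokernel

/-! ### Cokernels of matrices with corresponding entries -/

section FrobeniusCokernel

variable {p : ℕ} [Fact p.Prime] {A : Type u} [CommRing A] {B : Type u} [CommRing B] {a b : ℕ}
  {f : A →+* B}

/-- The relation between cokernels that is induced by `FrobRel`. -/
def FrobRelCoker (p : ℕ) [Fact p.Prime] (f : A →+* B) {b' : ℕ} (ψ : Matrix (Fin a) (Fin b) B)
    (φ : Matrix (Fin a) (Fin b') A) (y : Coker ψ) (x : Coker φ) : Prop :=
  ∃ (y' : Fin a → B) (x' : Fin a → A), Submodule.Quotient.mk y' = y ∧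
    Submodule.Quotient.mk x' = x ∧ ∀ i, FrobRel p f (y' i) (x' i)

variable {b' : ℕ} {ψ : Matrix (Fin a) (Fin b) B} {φ : Matrix (Fin a) (Fin b') A}

theorem FrobRelCoker.zero : FrobRelCoker p f ψ φ 0 0 :=
  ⟨0, 0, rfl, rfl, fun _ => FrobRel.zero⟩

theorem FrobRelCoker.add {y y' : Coker ψ} {x x' : Coker φ} (h : FrobRelCoker p f ψ φ y x)
    (h' : FrobRelCoker p f ψ φ y' x') : FrobRelCoker p f ψ φ (y + y') (x + x') := by
  obtain ⟨v, w, rfl, rfl, h⟩ := h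
  obtain ⟨v', w', rfl, rfl, h'⟩ := h'
  exact ⟨v + v', w + w', rfl, rfl, fun i => (h i).add (h' i)⟩

theorem FrobRelCoker.sub {y y' : Coker ψ} {x x' : Coker φ} (h : FrobRelCoker p f ψ φ y x)
    (h' : FrobRelCoker p f ψ φ y' x') : FrobRelCoker p f ψ φ (y - y') (x - x') := by
  obtain ⟨v, w, rfl, rfl, h⟩ := h
  obtain ⟨v', w', rfl, rfl, h'⟩ := h'
  exact ⟨v - v', w - w', rfl, rfl, fun i => (h i).sub (h' i)⟩

theorem FrobRelCoker.smul {t : B} {s : A} (hts : FrobRel p f t s) {y : Coker ψ} {x : Coker φ}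
    (h : FrobRelCoker p f ψ φ y x) : FrobRelCoker p f ψ φ (t • y) (s • x) := by
  obtain ⟨v, w, rfl, rfl, h⟩ := h
  exact ⟨t • v, s • w, rfl, rfl, fun i => hts.mul (h i)⟩

end FrobeniusCokernel

section FrobeniusLength

variable {p : ℕ} [Fact p.Prime] {A : Type u} [CommRing A] {B : Type u} [CommRing B] {a b : ℕ}
  {f : A →+* B} {ψ : Matrix (Fin a) (Fin b) B} {φ : Matrix (Fin a) (Fin b) A}

/-- If `x = φ v` and `s` corresponds to `v`, then Frobenius kills `y - ψ s`, which is thus divisible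
by `t`. -/
theorem mem_range_augment_of_frobRel {t : B} (ht : ∀ y, frobMod p B y = 0 → t ∣ y)
    (h : ∀ i j, FrobRel p f (ψ i j) (φ i j)) (hleft : ∀ x, ∃ y, FrobRel p f y x)
    {y : Fin a → B} {x : Fin a → A} (hyx : ∀ i, FrobRel p f (y i) (x i))
    (hx : x ∈ LinearMap.range φ.mulVecLin) : y ∈ LinearMap.range (augment ψ t).mulVecLin := by
  obtain ⟨v, rfl⟩ := hx
  choose s hs using fun j => hleft (v j)
  choose w hw using fun i => ht (y i - ψ.mulVec s i) (by
    have := (hyx i).sub (FrobRel.mulVec h hs i)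
    rwa [FrobRel, Matrix.mulVecLin_apply, sub_self, map_zero, map_zero] at this)
  refine mem_range_augment.mpr ⟨s, w, ?_⟩
  ext i
  rw [Pi.add_apply, Pi.smul_apply, smul_eq_mul, ← hw, add_sub_cancel]

/-- The relation need not be single-valued, since `p` may act nontrivially on `coker φ`; hence only
an inequality. -/
theorem length_coker_augment_le_of_frobRel {t : B} (ht : ∀ y, frobMod p B y = 0 → t ∣ y)
    (h : ∀ i j, FrobRel p f (ψ i j) (φ i j))
    (hleft : ∀ x, ∃ y, FrobRel p f y x) (hright : ∀ y, ∃ x, FrobRel p f y x) :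
    Module.length B (Coker (augment ψ t)) ≤ Module.length A (Coker φ) := by
  refine length_le_of_rel (FrobRelCoker p f (augment ψ t) φ) FrobRelCoker.zero
    (fun _ _ _ _ => FrobRelCoker.add) (fun _ _ _ _ => FrobRelCoker.sub) ?_ ?_ ?_
  · intro s
    obtain ⟨t, ht⟩ := hleft s
    exact ⟨t, fun _ _ => FrobRelCoker.smul ht⟩
  · intro y
    obtain ⟨y, rfl⟩ := Submodule.Quotient.mk_surjective _ y
    choose x hx using fun i => hright (y i)
    exact ⟨_, y, x, rfl, rfl, hx⟩
  · rintro _ ⟨y, x, rfl, hx, hyx⟩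
    rw [Submodule.Quotient.mk_eq_zero] at hx ⊢
    exact mem_range_augment_of_frobRel ht h hleft hyx hx

theorem mem_range_augment_of_frobRel' (hf : ∀ x, (p : B) ∣ f x → (p : A) ∣ x)
    (h : ∀ i j, FrobRel p f (ψ i j) (φ i j)) (hright : ∀ y, ∃ x, FrobRel p f y x)
    {y : Fin a → B} {x : Fin a → A} (hyx : ∀ i, FrobRel p f (y i) (x i))
    (hy : y ∈ LinearMap.range ψ.mulVecLin) : x ∈ LinearMap.range (augment φ (p : A)).mulVecLin := by
  obtain ⟨v, rfl⟩ := hy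
  choose s hs using fun j => hright (v j)
  choose w hw using fun i => hf (x i - φ.mulVec s i) (by
    have := (hyx i).sub (FrobRel.mulVec h hs i)
    rwa [FrobRel, Matrix.mulVecLin_apply, sub_self, map_zero, eq_comm, mk_eq_zero_iff_dvd] at this)
  refine mem_range_augment.mpr ⟨s, w, ?_⟩
  ext i
  rw [Pi.add_apply, Pi.smul_apply, smul_eq_mul, ← hw, add_sub_cancel]

theorem length_coker_augment_natCast_le_of_frobRel (hf : ∀ x, (p : B) ∣ f x → (p : A) ∣ x)
    (h : ∀ i j, FrobRel p f (ψ i j) (φ i j))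
    (hleft : ∀ x, ∃ y, FrobRel p f y x) (hright : ∀ y, ∃ x, FrobRel p f y x) :
    Module.length A (Coker (augment φ (p : A))) ≤ Module.length B (Coker ψ) := by
  refine length_le_of_rel (fun x y => FrobRelCoker p f ψ (augment φ (p : A)) y x) FrobRelCoker.zero
    (fun _ _ _ _ => FrobRelCoker.add) (fun _ _ _ _ => FrobRelCoker.sub) ?_ ?_ ?_
  · intro s
    obtain ⟨t, ht⟩ := hright s
    exact ⟨t, fun _ _ => FrobRelCoker.smul ht⟩
  · intro x
    obtain ⟨x, rfl⟩ := Submodule.Quotient.mk_surjective _ x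
    choose y hy using fun i => hleft (x i)
    exact ⟨_, y, x, rfl, rfl, hy⟩
  · rintro _ ⟨y, x, hy, rfl, hyx⟩
    rw [Submodule.Quotient.mk_eq_zero] at hy ⊢
    exact mem_range_augment_of_frobRel' hf h hright hyx hy

end FrobeniusLength

/-! ### The first level as a module over the bottom level -/

section Generators

variable (V : Type u) [CommRing V] (p d : ℕ) [Fact p.Prime]

open Polynomial in
theorem exists_eq_sum_pRoot_one (y : RootRing V p 1) :
    ∃ c : Fin p → RootRing V p 0,
      y = ∑ j, rootTransition V p 0 1 zero_le_one (c j) * pRoot V p 1 ^ (j : ℕ) := by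
  have hp := (Fact.out : p.Prime)
  cases subsingleton_or_nontrivial V
  · have : Subsingleton (RootRing V p 1) := (AdjoinRoot.of _).codomain_trivial
    exact ⟨0, Subsingleton.elim _ _⟩
  have hm := monic_X_pow_sub_natCast V p 1
  set q := AdjoinRoot.modByMonicHom hm y with hq
  have hy : y = AdjoinRoot.mk _ q := (AdjoinRoot.mk_leftInverse hm y).symm
  have hdeg : q.natDegree < p := by
    obtain ⟨h, rfl⟩ := AdjoinRoot.mk_surjective y
    rw [hq, AdjoinRoot.modByMonicHom_mk]
    have := natDegree_modByMonic_lt h hm (by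
        intro h1
        have := congrArg natDegree h1
        rw [natDegree_X_pow_sub_C, natDegree_one, pow_one] at this
        exact hp.ne_zero this)
    rw [natDegree_X_pow_sub_C] at this
    exact this.trans_eq (pow_one p)
  refine ⟨fun j => AdjoinRoot.of _ (q.coeff j), ?_⟩
  conv_lhs =>
    rw [hy, q.as_sum_range' p hdeg,
      ← Fin.sum_univ_eq_sum_range (fun i => monomial i (q.coeff i)), map_sum]
  refine Finset.sum_congr rfl fun j _ => ?_
  rw [rootTransition_of, ← C_mul_X_pow_eq_monomial, map_mul, map_pow, AdjoinRoot.mk_C,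
    AdjoinRoot.mk_X]
  rfl

/-- Every power series decomposes according to the residues of its exponents modulo `q`. -/
theorem eq_sum_expand_mul_monomial {σ A : Type*} [Fintype σ] [DecidableEq σ] [CommRing A] {q : ℕ}
    (hq : q ≠ 0) (f : MvPowerSeries σ A) : ∃ h : (σ → Fin q) → MvPowerSeries σ A,
      f = ∑ r, MvPowerSeries.expand q hq (h r) *
        MvPowerSeries.monomial (Finsupp.equivFunOnFinite.symm fun i => (r i : ℕ)) 1 := by
  choose h hh using fun r : σ → Fin q => exists_forall_coeff_eq fun m =>
    MvPowerSeries.coeff (q • m + Finsupp.equivFunOnFinite.symm fun i => (r i : ℕ)) f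
  refine ⟨h, ?_⟩
  ext m
  rw [map_sum]
  simp only [MvPowerSeries.coeff_mul_monomial, mul_one]
  have hq0 : 0 < q := Nat.pos_of_ne_zero hq
  -- Only the residue class of `m` itself contributes to the coefficient at `m`.
  let r₀ : σ → Fin q := fun i => ⟨m i % q, Nat.mod_lt _ hq0⟩
  rw [Finset.sum_eq_single r₀]
  · have h1 : (Finsupp.equivFunOnFinite.symm fun i => (r₀ i : ℕ)) ≤ m := fun i => Nat.mod_le _ _
    have h2 : m - (Finsupp.equivFunOnFinite.symm fun i => (r₀ i : ℕ)) =
        q • m.mapRange (· / q) (Nat.zero_div q) := by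
      ext i
      have := Nat.div_add_mod (m i) q
      simp only [r₀, Finsupp.tsub_apply, Finsupp.smul_apply, Finsupp.mapRange_apply, smul_eq_mul,
        Finsupp.equivFunOnFinite_symm_apply_apply]
      omega
    rw [if_pos h1, h2, MvPowerSeries.coeff_expand_smul, hh, ← h2, tsub_add_cancel_of_le h1]
  · intro r _ hr
    split_ifs with hle
    · obtain ⟨i, hi⟩ := Function.ne_iff.mp hr
      refine MvPowerSeries.coeff_expand_of_not_dvd q hq (h r) (i := i) fun ⟨k, hk⟩ => hi ?_
      have h3 : (r i : ℕ) ≤ m i := hle i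
      simp only [Finsupp.tsub_apply, Finsupp.equivFunOnFinite_symm_apply_apply] at hk
      have h4 : m i = r i + q * k := by omega
      refine Fin.ext ?_
      change (r i : ℕ) = m i % q
      rw [h4, Nat.add_mul_mod_self_left, Nat.mod_eq_of_lt (r i).2]
    · rfl
  · simp

theorem exists_eq_sum_level_one (y : Level V p d 1) :
    ∃ c : (Fin (d - 1) → Fin p) × Fin p → Level V p d 0,
      y = ∑ k, nextLevel V p d 0 (c k) * (MvPowerSeries.C (pRoot V p 1 ^ (k.2 : ℕ)) *
        MvPowerSeries.monomial (Finsupp.equivFunOnFinite.symm fun i => (k.1 i : ℕ)) 1) := by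
  obtain ⟨h, hy⟩ := eq_sum_expand_mul_monomial (Fact.out : p.Prime).ne_zero y
  choose c hc using fun r m => exists_eq_sum_pRoot_one V p (MvPowerSeries.coeff m (h r))
  choose C hC using fun k : (Fin (d - 1) → Fin p) × Fin p =>
    exists_forall_coeff_eq fun m => c k.1 m k.2
  refine ⟨C, ?_⟩
  rw [hy, Fintype.sum_prod_type]
  refine Finset.sum_congr rfl fun r _ => ?_
  have hr : h r = ∑ j : Fin p, MvPowerSeries.map (rootTransition V p 0 1 zero_le_one) (C (r, j)) *
      MvPowerSeries.C (pRoot V p 1 ^ (j : ℕ)) := by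
    ext m
    rw [hc, map_sum]
    refine Finset.sum_congr rfl fun j _ => ?_
    rw [MvPowerSeries.coeff_mul_C, MvPowerSeries.coeff_map, hC]
  rw [hr, map_sum, Finset.sum_mul]
  refine Finset.sum_congr rfl fun j _ => ?_
  rw [map_mul, MvPowerSeries.expand_C, nextLevel_apply, mul_assoc]

/-- `R_1` is generated over `R_0` by `p^{d-1}` monomials times `p` powers of `p^{1/p}`. This moves
presentations at level `0`, which has no predecessor, up to level `1`. -/
theorem length_coker_map_nextLevel_zero_le (hd : 1 ≤ d) {a b : ℕ}
    (φ : Matrix (Fin a) (Fin b) (Level V p d 0)) :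
    Module.length (Level V p d 1) (Coker (φ.map (nextLevel V p d 0))) ≤
      (p ^ d : ℕ) * Module.length (Level V p d 0) (Coker φ) := by
  have hcard : Fintype.card ((Fin (d - 1) → Fin p) × Fin p) = p ^ d := by
    simp [← pow_succ, Nat.sub_add_cancel hd]
  rw [← hcard]
  exact length_coker_map_le _ _ (exists_eq_sum_level_one V p d) φ

end Generators

/-! ### Torsion presentations -/

section Presentation

variable {V : Type u} [CommRing V] [IsLocalRing V] {p d : ℕ} [Fact p.Prime]

/-- The largest of the exponents for the finitely many standard generators serves all vectors. -/
theorem exists_forall_smul_mem_range {a b : ℕ} {Φ : Matrix (Fin a) (Fin b) (RInf V p d)}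
    (h : IsMTorsion V p d (Coker Φ)) :
    ∃ k : ℕ, ∀ z ∈ IsLocalRing.maximalIdeal (MvPowerSeries (Fin (d - 1)) V) ^ k,
      ∀ w : Fin a → RInf V p d, ofBase V p d z • w ∈ LinearMap.range Φ.mulVecLin := by
  choose k hk using fun i : Fin a => h (Submodule.Quotient.mk (Pi.single i 1))
  refine ⟨Finset.univ.sup k, fun z hz w => ?_⟩
  rw [pi_eq_sum_univ' w, Finset.smul_sum]
  refine Submodule.sum_mem _ fun i _ => ?_
  rw [smul_comm]
  refine Submodule.smul_mem _ _ ?_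
  have := hk i z (Ideal.pow_le_pow_right (Finset.le_sup (Finset.mem_univ i)) hz)
  rw [← Submodule.Quotient.mk_smul, Submodule.Quotient.mk_eq_zero] at this
  convert this using 3

theorem isMTorsion_coker {a b : ℕ} {Φ : Matrix (Fin a) (Fin b) (RInf V p d)}
    (h : ∃ k : ℕ, ∀ z ∈ IsLocalRing.maximalIdeal (MvPowerSeries (Fin (d - 1)) V) ^ k,
      ∀ w : Fin a → RInf V p d, ofBase V p d z • w ∈ LinearMap.range Φ.mulVecLin) :
    IsMTorsion V p d (Coker Φ) := by
  intro m
  obtain ⟨k, hk⟩ := h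
  obtain ⟨w, rfl⟩ := Submodule.Quotient.mk_surjective _ m
  refine ⟨k, fun z hz => ?_⟩
  rw [← Submodule.Quotient.mk_smul, Submodule.Quotient.mk_eq_zero]
  exact hk z hz w

theorem IsMTorsion.of_linearEquiv {M : Type*} {N : Type*} [AddCommGroup M]
    [Module (RInf V p d) M] [AddCommGroup N] [Module (RInf V p d) N] (h : IsMTorsion V p d M)
    (e : M ≃ₗ[RInf V p d] N) : IsMTorsion V p d N := by
  intro n
  obtain ⟨k, hk⟩ := h (e.symm n)
  refine ⟨k, fun z hz => e.symm.injective ?_⟩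
  rw [map_smul, hk z hz, map_zero]

instance {a b : ℕ} (Φ : Matrix (Fin a) (Fin b) (RInf V p d)) :
    Module.FinitePresentation (RInf V p d) (Coker Φ) :=
  Module.finitePresentation_of_surjective (Submodule.mkQ _) (Submodule.mkQ_surjective _) <| by
    rw [Submodule.ker_mkQ, LinearMap.range_eq_map]
    exact Module.Finite.fg_top.map _

/-- A matrix over `R_n` covers the module `N` if its cokernel over `R_∞` is `𝔪`-torsion and maps
onto `N`. -/
def Covers {n a b : ℕ} (φ : Matrix (Fin a) (Fin b) (Level V p d n)) (N : Type w) [AddCommGroup N]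
    [Module (RInf V p d) N] : Prop :=
  IsMTorsion V p d (Coker (φ.map (ofLevel V p d n))) ∧
    ∃ g : (Fin a → RInf V p d) →ₗ[RInf V p d] N, Function.Surjective g ∧
      ∀ x ∈ LinearMap.range (φ.map (ofLevel V p d n)).mulVecLin, g x = 0

/-- A cokernel over `R_∞` is itself an admissible finitely presented module, and conversely each
presentation that enters `lengthFP` is such a cokernel. -/
theorem lengthFG_eq_iInf_covers (N : Type w) [AddCommGroup N] [Module (RInf V p d) N] :
    lengthFG V p d N =
      ⨅ (n : ℕ) (a : ℕ) (b : ℕ) (φ : Matrix (Fin a) (Fin b) (Level V p d n)) (_ : Covers φ N),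
        (Module.length (Level V p d n) (Coker φ) : ℝ≥0∞) / (p : ℝ≥0∞) ^ (d * n) := by
  apply le_antisymm
  · refine le_iInf fun n => le_iInf fun a => le_iInf fun b => le_iInf fun φ => le_iInf fun h => ?_
    obtain ⟨htors, g, hg, hker⟩ := h
    refine (iInf_le_of_le (Coker (φ.map (ofLevel V p d n))) <| iInf_le_of_le inferInstance <|
      iInf_le_of_le inferInstance <| iInf_le_of_le inferInstance <| iInf_le_of_le htors <|
      iInf_le_of_le ⟨Submodule.liftQ _ g hker, fun x => ?_⟩ <| iInf_le_of_le n <|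
      iInf_le_of_le a <| iInf_le_of_le b <| iInf_le_of_le φ <|
      iInf_le_of_le ⟨LinearEquiv.refl _ _⟩ le_rfl)
    obtain ⟨y, rfl⟩ := hg x
    exact ⟨Submodule.Quotient.mk y, Submodule.liftQ_apply _ _ _⟩
  · refine le_iInf fun P => le_iInf fun _ => le_iInf fun _ => le_iInf fun _ => le_iInf fun hP =>
      le_iInf fun ⟨f, hf⟩ => le_iInf fun n => le_iInf fun a => le_iInf fun b => le_iInf fun φ =>
      le_iInf fun ⟨e⟩ => ?_
    refine iInf_le_of_le n <| iInf_le_of_le a <| iInf_le_of_le b <| iInf_le_of_le φ <|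
      iInf_le_of_le ⟨hP.of_linearEquiv e, (f ∘ₗ e.symm.toLinearMap) ∘ₗ Submodule.mkQ _,
        (hf.comp e.symm.surjective).comp (Submodule.mkQ_surjective _), fun x hx => ?_⟩ le_rfl
    rw [LinearMap.comp_apply, Submodule.mkQ_apply, (Submodule.Quotient.mk_eq_zero _).mpr hx,
      map_zero]

theorem Covers.lengthFG_le {N : Type w} [AddCommGroup N] [Module (RInf V p d) N] {n a b : ℕ}
    {φ : Matrix (Fin a) (Fin b) (Level V p d n)} (h : Covers φ N) :
    lengthFG V p d N ≤
      (Module.length (Level V p d n) (Coker φ) : ℝ≥0∞) / (p : ℝ≥0∞) ^ (d * n) := by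
  rw [lengthFG_eq_iInf_covers]
  exact iInf_le_of_le n <| iInf_le_of_le a <| iInf_le_of_le b <| iInf_le_of_le φ <|
    iInf_le_of_le h le_rfl

theorem Covers.map_nextLevel {N : Type w} [AddCommGroup N] [Module (RInf V p d) N] {n a b : ℕ}
    {φ : Matrix (Fin a) (Fin b) (Level V p d n)} (h : Covers φ N) :
    Covers (φ.map (nextLevel V p d n)) N := by
  have : (φ.map (nextLevel V p d n)).map (ofLevel V p d (n + 1)) = φ.map (ofLevel V p d n) := by
    ext i j
    exact ofLevel_levelTransition n.le_succ (φ i j)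
  rwa [Covers, this]

end Presentation

/-! ### Presentations of the Frobenius twist -/

section TwistPresentation

variable {V : Type u} [CommRing V] [IsLocalRing V] {p d : ℕ} [Fact p.Prime]

/-- On `N'` the scalar `y i` acts as `(y i)^p` does on `N`, hence as `x i`, because `p` kills `N`.
-/
theorem apply_eq_apply_of_frobRel {A : Type*} [CommRing A] {N N' : Type*} [AddCommGroup N]
    [Module A N] [AddCommGroup N'] [Module A N'] (hpN : ∀ x : N, (p : A) • x = 0) (e : N ≃+ N')
    (he : ∀ (c : A) (x : N), c • e x = e (c ^ p • x)) {a : ℕ} {g : (Fin a → A) →ₗ[A] N}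
    {g' : (Fin a → A) →ₗ[A] N'} (hg : ∀ i, g' (Pi.single i 1) = e (g (Pi.single i 1)))
    {y x : Fin a → A} (hyx : ∀ i, FrobRel p (RingHom.id A) (y i) (x i)) : g' y = e (g x) := by
  have hsingle : ∀ v : Fin a → A, v = ∑ i, v i • Pi.single i (1 : A) := fun v => by
    ext j
    simp [Pi.single_apply]
  conv_lhs => rw [hsingle y]
  conv_rhs => rw [hsingle x]
  simp only [map_sum, map_smul]
  refine Finset.sum_congr rfl fun i _ => ?_
  rw [hg, he]
  congr 1
  obtain ⟨r, hr⟩ := mk_eq_mk_iff_dvd.mp ((frobMod_apply p (y i)).symm.trans (hyx i))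
  rw [← sub_eq_zero, ← sub_smul, ← RingHom.id_apply (x i), hr, mul_smul, hpN]

theorem frobRel_pow {A : Type*} [CommRing A] (y : A) : FrobRel p (RingHom.id A) y (y ^ p) := rfl

variable {N N' : Type w} [AddCommGroup N] [Module (RInf V p d) N] [AddCommGroup N']
  [Module (RInf V p d) N']

theorem Covers.twist
    (hpN : ∀ x : N, (p : RInf V p d) • x = 0) (e : N ≃+ N')
    (he : ∀ (c : RInf V p d) (x : N), c • e x = e (c ^ p • x))
    (hV : ∀ v : V, ∃ w, (p : V) ∣ w ^ p - v)
    (hV' : ∀ v : V, (p : V) ∣ v ^ p → (p : V) ∣ v) {n a b : ℕ}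
    {φ : Matrix (Fin a) (Fin b) (Level V p d n)}
    {ψ : Matrix (Fin a) (Fin b) (Level V p d (n + 1))}
    (hψ : ∀ i j, FrobRel p (nextLevel V p d n) (ψ i j) (φ i j)) (h : Covers φ N) :
    Covers (augment ψ (pthRoot V p d n)) N' := by
  obtain ⟨htors, g, hg, hker⟩ := h
  have hΨ : ∀ i j, FrobRel p (RingHom.id _) (ψ.map (ofLevel V p d (n + 1)) i j)
      (φ.map (ofLevel V p d n) i j) := fun i j => (hψ i j).ofLevel
  rw [Covers, augment_map]
  constructor
  · obtain ⟨k, hk⟩ := exists_forall_smul_mem_range htors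
    refine isMTorsion_coker ⟨k, fun z hz w => ?_⟩
    refine mem_range_augment_of_frobRel (pthRoot_dvd_of_frobMod_eq_zero_RInf hV' n) hΨ
      (exists_frobRel_RInf hV) (fun i => frobRel_pow _) ?_
    -- The vector `z w` corresponds to `z^p w^p`, and `z^p` stays in the same power of the maximal
    -- ideal.
    convert hk (z ^ p) (Ideal.pow_mem_of_mem _ hz p (Fact.out : p.Prime).pos) (fun i => w i ^ p)
      using 1
    ext i
    simp [mul_pow]
  · have hg' : ∀ i, Fintype.linearCombination (RInf V p d) (fun i => e (g (Pi.single i 1)))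
        (Pi.single i 1) = e (g (Pi.single i 1)) := fun i => by
      rw [Fintype.linearCombination_apply_single, one_smul]
    have key := fun (y x : Fin a → RInf V p d) => apply_eq_apply_of_frobRel (y := y) (x := x)
      hpN e he hg'
    refine ⟨Fintype.linearCombination (RInf V p d) fun i => e (g (Pi.single i 1)),
      fun x => ?_, fun x hx => ?_⟩
    · obtain ⟨v, hv⟩ := hg (e.symm x)
      choose s hs using fun i => exists_frobRel_RInf hV (v i)
      exact ⟨s, by rw [key s v hs, hv, e.apply_symm_apply]⟩
    · obtain ⟨v, w, rfl⟩ := mem_range_augment.mp hx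
      -- The summand `p^{1/p} w` is killed by Frobenius, so `ψ v + p^{1/p} w` corresponds to `φ`
      -- applied to the `p`-th powers of `v`.
      rw [key _ ((φ.map (ofLevel V p d n)).mulVec fun j => v j ^ p),
        hker _ ⟨_, Matrix.mulVecLin_apply _ _⟩, map_zero]
      intro i
      have := FrobRel.mulVec hΨ (fun j => frobRel_pow (v j)) i
      rwa [FrobRel, Pi.add_apply, map_add, Pi.smul_apply, smul_eq_mul, map_mul,
        frobMod_ofLevel_pthRoot, zero_mul, add_zero]

theorem Covers.untwist [IsNoetherianRing V]
    (hpN : ∀ x : N, (p : RInf V p d) • x = 0) (e : N ≃+ N')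
    (he : ∀ (c : RInf V p d) (x : N), c • e x = e (c ^ p • x))
    (hV : ∀ v : V, ∃ w, (p : V) ∣ w ^ p - v)
    {n a b : ℕ}
    {φ : Matrix (Fin a) (Fin b) (Level V p d n)}
    {ψ : Matrix (Fin a) (Fin b) (Level V p d (n + 1))}
    (hψ : ∀ i j, FrobRel p (nextLevel V p d n) (ψ i j) (φ i j)) (h : Covers ψ N') :
    Covers (augment φ (p : Level V p d n)) N := by
  obtain ⟨htors, g, hg, hker⟩ := h
  have hΨ : ∀ i j, FrobRel p (RingHom.id _) (ψ.map (ofLevel V p d (n + 1)) i j)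
      (φ.map (ofLevel V p d n) i j) := fun i j => (hψ i j).ofLevel
  rw [Covers, augment_map, show ofLevel V p d n (p : Level V p d n) = p from map_natCast _ p]
  constructor
  · obtain ⟨k, hk⟩ := exists_forall_smul_mem_range htors
    let J : Ideal (MvPowerSeries (Fin (d - 1)) V) :=
      { carrier := {z | ∀ w : Fin a → RInf V p d, ofBase V p d z • w ∈
          LinearMap.range (augment (φ.map (ofLevel V p d n)) (p : RInf V p d)).mulVecLin}
        zero_mem' := fun w => by rw [map_zero, zero_smul]; exact Submodule.zero_mem _
        add_mem' := fun hx hy w => by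
          rw [map_add, add_smul]; exact Submodule.add_mem _ (hx w) (hy w)
        smul_mem' := fun c x hx w => by
          rw [smul_eq_mul, map_mul, mul_smul]; exact Submodule.smul_mem _ _ (hx w) }
    -- Frobenius only shows that `z^{kp}` lies in `J` for each `z` in the maximal ideal. Since that
    -- ideal is finitely generated, this still puts a power of it inside `J`.
    have hJ : IsLocalRing.maximalIdeal (MvPowerSeries (Fin (d - 1)) V) ≤ J.radical := by
      refine fun z hz => ⟨k * p, fun w => ?_⟩
      choose s hs using fun i => exists_frobRel_RInf hV (w i)
      -- With `s` corresponding to `w`, the vector `z^k s` corresponds to `z^{kp} w`.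
      refine mem_range_augment_of_frobRel' (fun x => id) hΨ (fun y => ⟨_, frobRel_pow y⟩)
        (fun i => ?_) (hk _ (Ideal.pow_mem_pow hz k) s)
      rw [pow_mul, map_pow (ofBase V p d) (z ^ k)]
      exact (frobRel_pow _).mul (hs i)
    obtain ⟨m, hm⟩ := Ideal.exists_pow_le_of_le_radical_of_fg hJ (IsNoetherian.noetherian _)
    exact isMTorsion_coker ⟨m, fun z hz => hm hz⟩
  · have hg' : ∀ i, g (Pi.single i 1) = e (Fintype.linearCombination (RInf V p d)
        (fun i => e.symm (g (Pi.single i 1))) (Pi.single i 1)) := fun i => by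
      rw [Fintype.linearCombination_apply_single, one_smul, e.apply_symm_apply]
    have key := fun (y x : Fin a → RInf V p d) => apply_eq_apply_of_frobRel (y := y) (x := x)
      hpN e he hg'
    refine ⟨Fintype.linearCombination (RInf V p d) fun i => e.symm (g (Pi.single i 1)),
      fun x => ?_, fun x hx => ?_⟩
    · obtain ⟨v, hv⟩ := hg (e x)
      exact ⟨_, e.injective ((key v _ fun i => frobRel_pow (v i)).symm.trans hv)⟩
    · obtain ⟨v, w, rfl⟩ := mem_range_augment.mp hx
      choose s hs using fun j => exists_frobRel_RInf hV (v j)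
      rw [map_add, map_smul, hpN, add_zero]
      refine e.injective ?_
      rw [← key _ _ (FrobRel.mulVec hΨ hs), hker _ ⟨_, Matrix.mulVecLin_apply _ _⟩, map_zero]

theorem lengthFG_twist [IsNoetherianRing V]
    (hpN : ∀ x : N, (p : RInf V p d) • x = 0) (e : N ≃+ N')
    (he : ∀ (c : RInf V p d) (x : N), c • e x = e (c ^ p • x))
    (hV : ∀ v : V, ∃ w, (p : V) ∣ w ^ p - v)
    (hV' : ∀ v : V, (p : V) ∣ v ^ p → (p : V) ∣ v)
    (hd : 1 ≤ d) : lengthFG V p d N' = ((p : ℝ≥0∞) ^ d)⁻¹ * lengthFG V p d N := by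
  have hp0 : (p : ℝ≥0∞) ^ d ≠ 0 := pow_ne_zero _ (by exact_mod_cast (Fact.out : p.Prime).ne_zero)
  have hpt : (p : ℝ≥0∞) ^ d ≠ ⊤ := ENNReal.pow_ne_top (ENNReal.natCast_ne_top p)
  -- One level up divides the normalization by `p^d`: the source of the factor.
  have hdiv : ∀ (n : ℕ) (l : ℝ≥0∞), l / (p : ℝ≥0∞) ^ (d * (n + 1)) =
      ((p : ℝ≥0∞) ^ d)⁻¹ * (l / (p : ℝ≥0∞) ^ (d * n)) := by
    intro n l
    rw [mul_add, mul_one, pow_add, div_eq_mul_inv, div_eq_mul_inv,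
      ENNReal.mul_inv (Or.inr hpt) (Or.inr hp0)]
    ring
  have hsucc : ∀ (n a b : ℕ) (ψ : Matrix (Fin a) (Fin b) (Level V p d (n + 1))), Covers ψ N' →
      ((p : ℝ≥0∞) ^ d)⁻¹ * lengthFG V p d N ≤
        (Module.length (Level V p d (n + 1)) (Coker ψ) : ℝ≥0∞) / (p : ℝ≥0∞) ^ (d * (n + 1)) := by
    intro n a b ψ h
    choose φ hφ using fun i j => exists_frobRel_right n (ψ i j)
    rw [hdiv]
    have hlen := length_coker_augment_natCast_le_of_frobRel natCast_dvd_of_natCast_dvd_nextLevel hφ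
      (exists_frobRel_left hV n) (exists_frobRel_right n)
    gcongr
    exact (h.untwist hpN e he hV hφ).lengthFG_le.trans (by gcongr)
  apply le_antisymm
  · rw [lengthFG_eq_iInf_covers N]
    simp only [ENNReal.mul_iInf_of_ne (ENNReal.inv_ne_zero.mpr hpt) (ENNReal.inv_ne_top.mpr hp0)]
    refine le_iInf fun n => le_iInf fun a => le_iInf fun b => le_iInf fun φ => le_iInf fun h => ?_
    choose ψ hψ using fun i j => exists_frobRel_left hV n (φ i j)
    have hlen := length_coker_augment_le_of_frobRel (pthRoot_dvd_of_frobMod_eq_zero hV') hψ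
      (exists_frobRel_left hV n) (exists_frobRel_right n)
    rw [← hdiv]
    exact (h.twist hpN e he hV hV' hψ).lengthFG_le.trans (by gcongr)
  · rw [lengthFG_eq_iInf_covers N']
    refine le_iInf fun n => le_iInf fun a => le_iInf fun b => le_iInf fun ψ => le_iInf fun h => ?_
    cases n with
    | succ n => exact hsucc n a b ψ h
    | zero =>
      -- Passing to level `1` multiplies the length by at most `p^d`, which the normalization
      -- absorbs.
      refine (hsucc 0 a b _ h.map_nextLevel).trans ?_
      have hdiv0 : ∀ l : ℝ≥0∞, l / (p : ℝ≥0∞) ^ (d * 0) = l := fun l => by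
        rw [mul_zero, pow_zero, div_one]
      rw [hdiv, hdiv0, hdiv0]
      have := ENat.toENNReal_le.mpr (length_coker_map_nextLevel_zero_le V p d hd ψ)
      calc _ ≤ ((p : ℝ≥0∞) ^ d)⁻¹ * ((p : ℝ≥0∞) ^ d *
            (Module.length (Level V p d 0) (Coker ψ) : ℝ≥0∞)) := by
            gcongr
            simpa using this
        _ = _ := by rw [← mul_assoc, ENNReal.inv_mul_cancel hp0 hpt, one_mul]

end TwistPresentation

/-! ### Submodules of the Frobenius twist -/

section Submodules

variable {A : Type u} [CommRing A] {p : ℕ} [Fact p.Prime] {M : Type w} [AddCommGroup M] [Module A M]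

theorem smul_eq_pow_smul_of_frobRel (hM : ∀ m : M, (p : A) • m = 0) {s c : A}
    (h : FrobRel p (RingHom.id A) s c) (m : M) :
    c • m = s ^ p • m := by
  obtain ⟨r, hr⟩ := mk_eq_mk_iff_dvd.mp ((frobMod_apply p s).symm.trans h)
  rw [eq_comm, ← sub_eq_zero, ← sub_smul, ← RingHom.id_apply c, hr, mul_smul, hM]

/-- A module and its Frobenius twist have the same submodules. -/
def submoduleTwist (hM : ∀ m : M, (p : A) • m = 0)
    (hA : ∀ c : A, ∃ s, FrobRel p (RingHom.id A) s c) :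
    Submodule A M ≃o Submodule A (FrobeniusTwist A p M hM) where
  toFun N :=
    { carrier := {x | (toTwist hM).symm x ∈ N}
      zero_mem' := N.zero_mem
      add_mem' := N.add_mem
      smul_mem' := fun c _ hx => N.smul_mem (c ^ p) hx }
  invFun N :=
    { carrier := {x | toTwist hM x ∈ N}
      zero_mem' := N.zero_mem
      add_mem' := N.add_mem
      smul_mem' := fun c x hx => by
        -- Stability under all scalars, not only `p`-th powers, comes from surjectivity of Frobenius
        -- modulo `p`.
        obtain ⟨s, hs⟩ := hA c
        change toTwist hM (c • x) ∈ N
        rw [smul_eq_pow_smul_of_frobRel hM hs, ← smul_toTwist]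
        exact N.smul_mem s hx }
  left_inv _ := rfl
  right_inv _ := rfl
  map_rel_iff' := Iff.rfl

theorem isCompactElement_apply_orderIso {α β : Type*} [PartialOrder α] [PartialOrder β]
    (f : α ≃o β) {x : α} (hx : IsCompactElement x) : IsCompactElement (f x) := by
  intro s u hs hdir hu hxu
  obtain ⟨_, ⟨z, hz, rfl⟩, hxz⟩ := hx (f.symm '' s) (f.symm u) (hs.image _)
    (by
      rintro _ ⟨y, hy, rfl⟩ _ ⟨z, hz, rfl⟩
      obtain ⟨t, ht, hyt, hzt⟩ := hdir y hy z hz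
      exact ⟨_, ⟨t, ht, rfl⟩, f.symm.monotone hyt, f.symm.monotone hzt⟩)
    (f.symm.isLUB_image'.mpr hu) ((f.le_symm_apply).mpr hxu)
  exact ⟨z, hz, (f.le_symm_apply).mp hxz⟩

theorem isCompactElement_orderIso_iff {α β : Type*} [PartialOrder α] [PartialOrder β]
    (f : α ≃o β) {x : α} : IsCompactElement (f x) ↔ IsCompactElement x :=
  ⟨fun h => by simpa using isCompactElement_apply_orderIso f.symm h,
    isCompactElement_apply_orderIso f⟩

/-- Finite generation is compactness in the lattice of submodules, which an order isomorphism
preserves. -/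
theorem fg_submoduleTwist_iff (hM : ∀ m : M, (p : A) • m = 0)
    (hA : ∀ c : A, ∃ s, FrobRel p (RingHom.id A) s c) (N : Submodule A M) :
    (submoduleTwist hM hA N).FG ↔ N.FG := by
  rw [Submodule.fg_iff_compact, Submodule.fg_iff_compact, isCompactElement_orderIso_iff]

end Submodules

/-! ### The pull-back formula -/

theorem normalizedLength_twist {V : Type u} [CommRing V] [IsLocalRing V] [IsNoetherianRing V]
    {p d : ℕ} [Fact p.Prime] (hV : ∀ v : V, ∃ w, (p : V) ∣ w ^ p - v)
    (hV' : ∀ v : V, (p : V) ∣ v ^ p → (p : V) ∣ v) (hd : 1 ≤ d)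
    {M : Type w} [AddCommGroup M] [Module (RInf V p d) M]
    (hM : ∀ m : M, (p : RInf V p d) • m = 0) :
    normalizedLength V p d (FrobeniusTwist (RInf V p d) p M hM) =
      ((p : ℝ≥0∞) ^ d)⁻¹ * normalizedLength V p d M := by
  have hA := exists_frobRel_RInf (V := V) (p := p) (d := d) hV
  simp only [normalizedLength, ENNReal.mul_iSup]
  rw [← (submoduleTwist hM hA).toEquiv.iSup_comp]
  refine iSup_congr fun N => iSup_congr_Prop (fg_submoduleTwist_iff hM hA N) fun _ => ?_
  let e : N ≃+ submoduleTwist hM hA N :=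
    { toFun := fun x => ⟨toTwist hM x, x.2⟩
      invFun := fun x => ⟨(toTwist hM).symm x, x.2⟩
      left_inv := fun _ => rfl
      right_inv := fun _ => rfl
      map_add' := fun _ _ => rfl }
  exact lengthFG_twist (fun x => Subtype.ext (hM x)) e (fun _ _ => rfl) hV hV' hd

end NormalizedLength
end

open NormalizedLength
theorem theorem2p12 {V : Type u} [CommRing V] [IsDomain V] [IsDiscreteValuationRing V]
    (p : ℕ) [Fact p.Prime]
    (hp : IsLocalRing.maximalIdeal V = Ideal.span {(p : V)})
    [IsAdicComplete (IsLocalRing.maximalIdeal V) V]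
    [PerfectField (IsLocalRing.ResidueField V)]
    (d : ℕ) (hd : 1 ≤ d)
    {M : Type w} [AddCommGroup M] [Module (RInf V p d) M]
    (hpM : ∀ m : M, (p : RInf V p d) • m = 0)
    (hM : IsMTorsion V p d M) :
    normalizedLength V p d (FrobeniusTwist (RInf V p d) p M hpM) =
      ((p : ℝ≥0∞) ^ d)⁻¹ * normalizedLength V p d M :=
  normalizedLength_twist (exists_natCast_dvd_pow_sub p hp) (natCast_dvd_of_dvd_pow p hp) hd hpM
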